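/- Let $K$ be a field and $n,m\ge 1$. Let $G_{n,m}=P_n\,\square\,P_m$ be the grid graph, with vertices $x_{i,j}$ ($1\le i\le n$, $1\le j\le m$), where $x_{i,j}$ and $x_{k,\ell}$ are adjacent if and only if $|i-k|+|j-\ell|=1$, and let $G=\overline{G_{n,m}}$ be its complement. Let $R=K[x_{i,j}\mid 1\le i\le n,\ 1\le j\le m]$ with the standard grading, and let $I_1(G)\subseteq R$ be the edge ideal of $G$, i.e. the ideal generated by the products $\prod_{x\in S}x$ over all two-element vertex sets $S$ for which $G[S]$ is connected. Then $$\operatorname{reg}(I_1(G))\le 3,$$ where $\operatorname{reg}(I)=\max\{\,j-i\mid \beta_{i,j}(I)\neq 0\,\}$ is the Castelnuovo--Mumford regularity (equal to $-\infty$ for $I=0$), and $\beta_{i,j}(I)$ is the number of summands $R(-j)$ in homological degree $i$ of the minimal graded free resolution of $I$. -/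

import Mathlib

open MvPolynomial

namespace ConnectedIdeal

/-- The grid graph `G_{n,m} = P_n □ P_m`, the Cartesian product of the paths on `n` and on `m`
vertices. -/
def gridGraph (n m : ℕ) : SimpleGraph (Fin n × Fin m) :=
  (SimpleGraph.pathGraph n).boxProd (SimpleGraph.pathGraph m)

/-- Two vertices of the grid graph are adjacent iff `|i - k| + |j - l| = 1`. -/
theorem gridGraph_adj {n m : ℕ} (x y : Fin n × Fin m) :
    (gridGraph n m).Adj x y ↔
      |((x.1 : ℕ) : ℤ) - ((y.1 : ℕ) : ℤ)| + |((x.2 : ℕ) : ℤ) - ((y.2 : ℕ) : ℤ)| = 1 := by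
  simp only [gridGraph, SimpleGraph.boxProd_adj, SimpleGraph.pathGraph_adj, Fin.ext_iff]
  rcases abs_cases (((x.1 : ℕ) : ℤ) - ((y.1 : ℕ) : ℤ)) with h | h <;>
    rcases abs_cases (((x.2 : ℕ) : ℤ) - ((y.2 : ℕ) : ℤ)) with h' | h' <;> omega

variable {σ K : Type*} [Field K]

/-- The `r`-connected ideal `I_r(G)` of a graph `G` in the polynomial ring over `K` with one variable
for each vertex: it is generated by the monomials `∏_{x ∈ S} x`, for the vertex sets `S` of size
`r + 1` that induce a connected subgraph. For `r = 1` it is the usual edge ideal. -/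
noncomputable def connectedIdeal (K : Type*) [Field K] (G : SimpleGraph σ) (r : ℕ) :
    Ideal (MvPolynomial σ K) :=
  Ideal.span {f | ∃ S : Finset σ, S.card = r + 1 ∧ (G.induce (S : Set σ)).Connected ∧
    f = ∏ x ∈ S, X x}

/-- `p` is homogeneous of degree `k`, where `k` is an integer: all monomials of `p` have total
degree `k`. So `0` is homogeneous of every degree, and nothing else is of negative degree. -/
def IsHomogeneousOfDegree (p : MvPolynomial σ K) (k : ℤ) : Prop :=
  ∀ s ∈ p.support, ((s.degree : ℕ) : ℤ) = k

/-- A graded free resolution `⋯ → F_1 → F_0 → I → 0` of an ideal `I` of the standard graded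
polynomial ring `R`, where `F_i = ⨁_b R(-shift i b)` is of finite rank. The map
`d i : F_{i+1} → F_i` and the augmentation `F_0 → I ⊆ R` are homogeneous of degree `0`; as the basis
vector `b` of `F_i` has degree `shift i b`, this is a condition on the entries of their matrices. -/
structure GradedFreeResolution (I : Ideal (MvPolynomial σ K)) where
  /-- The rank of `F_i`. -/
  rank : ℕ → ℕ
  /-- The degrees of the basis vectors of `F_i`. -/
  shift : ∀ i, Fin (rank i) → ℤ
  /-- The differential `F_{i+1} → F_i`. -/
  d : ∀ i, (Fin (rank (i + 1)) → MvPolynomial σ K) →ₗ[MvPolynomial σ K]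
    (Fin (rank i) → MvPolynomial σ K)
  /-- The augmentation `F_0 → I`, with its values seen in `R`. -/
  aug : (Fin (rank 0) → MvPolynomial σ K) →ₗ[MvPolynomial σ K] MvPolynomial σ K
  d_homogeneous : ∀ i (b : Fin (rank (i + 1))) (a : Fin (rank i)),
    IsHomogeneousOfDegree (d i (Pi.single b 1) a) (shift (i + 1) b - shift i a)
  aug_homogeneous : ∀ b : Fin (rank 0), IsHomogeneousOfDegree (aug (Pi.single b 1)) (shift 0 b)
  range_aug : LinearMap.range aug = I
  exact_zero : Function.Exact (d 0) aug
  exact_succ : ∀ i, Function.Exact (d (i + 1)) (d i)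

namespace GradedFreeResolution

variable {I : Ideal (MvPolynomial σ K)}

/-- A graded free resolution is minimal if the image of `F_{i+1}` lies in `𝔪 F_i` for all `i`, where
`𝔪` is generated by the variables, i.e. no matrix entry has a nonzero constant term. -/
def IsMinimal (F : GradedFreeResolution I) : Prop :=
  ∀ i (b : Fin (F.rank (i + 1))) (a : Fin (F.rank i)),
    constantCoeff (F.d i (Pi.single b 1) a) = 0

/-- The number of summands `R(-j)` of `F_i`. -/
def mult (F : GradedFreeResolution I) (i : ℕ) (j : ℤ) : ℕ :=
  Fintype.card {b : Fin (F.rank i) // F.shift i b = j}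

end GradedFreeResolution

open Classical in
/-- The graded Betti number `β_{i,j}(I)`: the number of summands `R(-j)` of `F_i`, in a minimal graded
free resolution `F` of `I` (which is unique up to isomorphism). If `I` had no such resolution, which
for homogeneous `I` in finitely many variables does not happen, the value would be the default `0`. -/
noncomputable def bettiNumber (I : Ideal (MvPolynomial σ K)) (i : ℕ) (j : ℤ) : ℕ :=
  if h : ∃ F : GradedFreeResolution I, F.IsMinimal then h.choose.mult i j else 0

open Classical in
/-- The Castelnuovo--Mumford regularity `sup {j - i | β_{i,j}(I) ≠ 0}`. It is `⊥ = -∞` for the zero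
ideal. An ideal without a minimal graded free resolution has the value `⊤`, so an upper bound on the
regularity includes the existence of such a resolution. -/
noncomputable def regularity (I : Ideal (MvPolynomial σ K)) : EReal :=
  if ∃ F : GradedFreeResolution I, F.IsMinimal then
    ⨆ (i : ℕ) (j : ℤ) (_ : bettiNumber I i j ≠ 0), (((j - (i : ℤ) : ℤ) : ℝ) : EReal)
  else ⊤

end ConnectedIdeal

/-! The grid is bipartite, hence triangle-free, so any three vertices contain an edge of its
complement `G`. Thus every squarefree monomial of degree at least 3 lies in the edge ideal `I`.

Graded Betti numbers are read off Koszul homology: `β_{i,j}(I)` is governed by Koszul `i`-cycles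
with coefficients in `I` of degree `j - i`, so it suffices that such cycles bound once the
coefficient degree exceeds 3. Over the whole ring there is a contracting homotopy: in each
multidegree choose a variable `x_v`, divide by it and wedge with its basis vector. Choosing `v` of
exponent at least 2 whenever possible keeps coefficients in `I`: either division does not shrink the
support of the monomial, or the quotient is squarefree of degree at least 3
(`koszulBounded_connectedIdeal_one`).

The vanishing is turned into a bound on the shifts of any minimal resolution by dimension shifting
along the syzygies (`KoszulBounded.ker`, `KoszulBounded.shift_le`). Existence of a minimal
resolution is proved separately, by iterating minimal covers (`exists_isMinimal`). -/

namespace ConnectedIdeal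

/-! ### The Koszul complex. -/

section Koszul

variable {σ : Type*} [LinearOrder σ]

/-- The sign of moving `v` into place in the wedge product of the elements of `S`. -/
def koszulSign (v : σ) (S : Finset σ) : ℤ :=
  (-1) ^ (S.filter (· < v)).card

theorem koszulSign_mul_self (v : σ) (S : Finset σ) : koszulSign v S * koszulSign v S = 1 := by
  rw [koszulSign, ← mul_pow]
  simp

theorem koszulSign_insert {v : σ} {S : Finset σ} (hv : v ∉ S) (u : σ) :
    koszulSign u (insert v S) = (if v < u then -1 else 1) * koszulSign u S := by
  unfold koszulSign
  rw [Finset.filter_insert]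
  split_ifs with h
  · rw [Finset.card_insert_of_notMem (by simp [hv]), pow_succ']
  · simp

theorem koszulSign_insert_self (v : σ) (S : Finset σ) :
    koszulSign v (insert v S) = koszulSign v S := by
  unfold koszulSign
  rw [Finset.filter_insert, if_neg (lt_irrefl v)]

/-- Exactly one of `u < v` and `v < u` holds, so exactly one of the two insertions flips a sign. -/
theorem koszulSign_anticomm {u v : σ} {S : Finset σ} (h : u ≠ v) (hu : u ∉ S) (hv : v ∉ S) :
    koszulSign u S * koszulSign v (insert u S) = -(koszulSign v S * koszulSign u (insert v S)) := by
  rw [koszulSign_insert hu, koszulSign_insert hv]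
  rcases lt_or_gt_of_ne h with h | h
  · rw [if_pos h, if_neg h.asymm]
    ring
  · rw [if_pos h, if_neg h.asymm]
    ring

variable [Fintype σ] {R : Type*} [CommRing R] {M M' : Type*} [AddCommGroup M] [Module R M]
  [AddCommGroup M'] [Module R M']

/-- The differential of the Koszul complex of the sequence `x` with coefficients in a module, all
homological degrees at once: a chain gives a coefficient to every wedge product of basis vectors. -/
def koszulD (x : σ → R) : (Finset σ → M) →ₗ[R] (Finset σ → M) where
  toFun f S := ∑ v ∈ Sᶜ, koszulSign v S • x v • f (insert v S)
  map_add' f g := by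
    ext S
    simp [smul_add, Finset.sum_add_distrib]
  map_smul' r f := by
    ext S
    simp only [Pi.smul_apply, RingHom.id_apply, Finset.smul_sum]
    refine Finset.sum_congr rfl fun v _ => ?_
    rw [smul_comm (x v) r, smul_comm (koszulSign v S) r]

theorem koszulD_apply (x : σ → R) (f : Finset σ → M) (S : Finset σ) :
    koszulD x f S = ∑ v ∈ Sᶜ, koszulSign v S • x v • f (insert v S) := rfl

theorem koszulD_map (x : σ → R) (φ : M →ₗ[R] M') (f : Finset σ → M) (S : Finset σ) :
    koszulD x (fun T => φ (f T)) S = φ (koszulD x f S) := by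
  simp [koszulD_apply, map_sum]

theorem koszulD_koszulD (x : σ → R) (f : Finset σ → M) : koszulD x (koszulD x f) = 0 := by
  ext S
  simp only [koszulD_apply, Pi.zero_apply, Finset.smul_sum]
  rw [Finset.sum_sigma']
  -- Swapping the order in which two elements are inserted pairs off the terms with opposite signs.
  refine Finset.sum_involution (fun p _ => ⟨p.2, p.1⟩) ?_ ?_ ?_ ?_
  · rintro ⟨u, v⟩ h
    simp only [Finset.mem_sigma, Finset.mem_compl, Finset.mem_insert, not_or] at h
    obtain ⟨hu, hvu, hv⟩ := h
    dsimp only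
    rw [smul_comm (x u) (koszulSign v (insert u S)), smul_comm (x v) (koszulSign u (insert v S)),
      smul_comm (x u) (x v), ← mul_smul (koszulSign u S), ← mul_smul (koszulSign v S),
      koszulSign_anticomm (Ne.symm hvu) hu hv, Finset.insert_comm u v, neg_smul, neg_add_cancel]
  · rintro ⟨u, v⟩ h _ h'
    simp only [Finset.mem_sigma, Finset.mem_compl, Finset.mem_insert, not_or] at h
    simp only [Sigma.mk.injEq] at h'
    exact h.2.1 h'.1
  · rintro ⟨u, v⟩ h
    simp only [Finset.mem_sigma, Finset.mem_compl, Finset.mem_insert, not_or] at h ⊢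
    exact ⟨h.2.2, fun h' => h.2.1 h'.symm, h.1⟩
  · rintro ⟨u, v⟩ h
    rfl

end Koszul

/-! ### Truncating polynomials to a set of exponents. -/

section Restrict

variable {σ K : Type*} [Field K]

open Classical in
/-- The part of a polynomial that consists of its monomials with exponents in `P`. -/
noncomputable def restrict (P : Set (σ →₀ ℕ)) (p : MvPolynomial σ K) : MvPolynomial σ K :=
  ∑ b ∈ p.support with b ∈ P, monomial b (coeff b p)

open Classical in
theorem coeff_restrict (P : Set (σ →₀ ℕ)) (p : MvPolynomial σ K) (b : σ →₀ ℕ) :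
    coeff b (restrict P p) = if b ∈ P then coeff b p else 0 := by
  simp only [restrict, coeff_sum, coeff_monomial, Finset.sum_ite_eq', Finset.mem_filter,
    mem_support_iff]
  by_cases h : coeff b p = 0 <;> simp [h]

end Restrict

/-! ### The multigraded contracting homotopy. -/

section Homotopy

variable {σ K : Type*} [Field K] [LinearOrder σ]

/-- The exponent of the squarefree monomial with support `S`. -/
noncomputable def indicatorExp (S : Finset σ) : σ →₀ ℕ := ∑ v ∈ S, Finsupp.single v 1

theorem indicatorExp_insert {v : σ} {S : Finset σ} (h : v ∉ S) :
    indicatorExp (insert v S) = Finsupp.single v 1 + indicatorExp S :=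
  Finset.sum_insert h

theorem indicatorExp_apply (S : Finset σ) (v : σ) :
    indicatorExp S v = if v ∈ S then 1 else 0 := by
  simp [indicatorExp, Finsupp.finsetSum_apply, Finsupp.single_apply]

/-- The operator on Koszul chains over the polynomial ring that, in multidegree `a`, divides by the
variable `pick a` and takes the wedge product with its basis vector. -/
noncomputable def koszulHomotopy (pick : (σ →₀ ℕ) → Option σ) (f : Finset σ → MvPolynomial σ K)
    (T : Finset σ) : MvPolynomial σ K :=
  ∑ v ∈ T, koszulSign v T •
    restrict {b | pick (b + indicatorExp T) = some v}
      ((f (T.erase v)).divMonomial (Finsupp.single v 1))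

open Classical in
theorem coeff_koszulHomotopy (pick : (σ →₀ ℕ) → Option σ) (f : Finset σ → MvPolynomial σ K)
    (T : Finset σ) (b : σ →₀ ℕ) :
    coeff b (koszulHomotopy pick f T) = ∑ v ∈ T, if pick (b + indicatorExp T) = some v then
      koszulSign v T • coeff (Finsupp.single v 1 + b) (f (T.erase v)) else 0 := by
  simp only [koszulHomotopy, coeff_sum]
  refine Finset.sum_congr rfl fun v _ => ?_
  rw [← smul_ite_zero, ← coeff_divMonomial]
  simp [coeff_restrict, ← Int.cast_smul_eq_zsmul K]

theorem coeff_koszulHomotopy_of_mem {pick : (σ →₀ ℕ) → Option σ} {f : Finset σ → MvPolynomial σ K}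
    {T : Finset σ} {b : σ →₀ ℕ} {v : σ} (h : pick (b + indicatorExp T) = some v) (hv : v ∈ T) :
    coeff b (koszulHomotopy pick f T) =
      koszulSign v T • coeff (Finsupp.single v 1 + b) (f (T.erase v)) := by
  rw [coeff_koszulHomotopy, h, Finset.sum_eq_single_of_mem v hv, if_pos rfl]
  intro u _ hu
  rw [if_neg]
  simpa using hu.symm

theorem coeff_koszulHomotopy_of_notMem {pick : (σ →₀ ℕ) → Option σ}
    {f : Finset σ → MvPolynomial σ K} {T : Finset σ} {b : σ →₀ ℕ}
    (h : ∀ v ∈ T, pick (b + indicatorExp T) ≠ some v) :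
    coeff b (koszulHomotopy pick f T) = 0 := by
  rw [coeff_koszulHomotopy]
  exact Finset.sum_eq_zero fun v hv => if_neg (h v hv)

theorem exists_of_mem_support_koszulHomotopy {pick : (σ →₀ ℕ) → Option σ}
    {f : Finset σ → MvPolynomial σ K} {T : Finset σ} {b : σ →₀ ℕ}
    (h : b ∈ (koszulHomotopy pick f T).support) :
    ∃ v ∈ T, pick (b + indicatorExp T) = some v ∧
      Finsupp.single v 1 + b ∈ (f (T.erase v)).support := by
  rw [mem_support_iff] at h
  by_contra! H
  apply h
  by_cases h' : ∃ v ∈ T, pick (b + indicatorExp T) = some v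
  · obtain ⟨v, hv, hp⟩ := h'
    rw [coeff_koszulHomotopy_of_mem hp hv, notMem_support_iff.1 (H v hv hp), smul_zero]
  · push Not at h'
    exact coeff_koszulHomotopy_of_notMem h'

variable [Fintype σ]

theorem coeff_koszulD (f : Finset σ → MvPolynomial σ K) (S : Finset σ) (b : σ →₀ ℕ) :
    coeff b (koszulD (X : σ → MvPolynomial σ K) f S) = ∑ u ∈ Sᶜ, koszulSign u S •
      if b u ≠ 0 then coeff (b - Finsupp.single u 1) (f (insert u S)) else 0 := by
  simp [koszulD_apply, coeff_sum, ← Int.cast_smul_eq_zsmul K, coeff_X_mul']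

/-- The coefficient of `b` at `S` has multidegree `b + indicatorExp S`, which the differential
preserves, so one variable `v` is picked throughout each computation. Only multidegree 0 offers no
variable, and `h0` disposes of it. -/
theorem koszulD_koszulHomotopy {pick : (σ →₀ ℕ) → Option σ}
    (hsome : ∀ a v, pick a = some v → a v ≠ 0) (hnone : ∀ a, pick a = none → a = 0)
    {f : Finset σ → MvPolynomial σ K} (hf : koszulD (X : σ → MvPolynomial σ K) f = 0) (h0 : constantCoeff (f ∅) = 0) :
    koszulD (X : σ → MvPolynomial σ K) (koszulHomotopy pick f) = f := by
  ext S b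
  rcases hp : pick (b + indicatorExp S) with _ | v
  · have h := hnone _ hp
    obtain ⟨rfl, hS⟩ : b = 0 ∧ indicatorExp S = 0 := by simpa using h
    obtain rfl : S = ∅ := by
      ext v
      have := indicatorExp_apply S v
      rw [hS] at this
      by_cases hv : v ∈ S <;> simp [hv] at this ⊢
    rw [coeff_koszulD]
    rw [constantCoeff_eq] at h0
    simp [h0]
  have hne := hsome _ _ hp
  have key : ∀ u ∉ S, b u ≠ 0 →
      pick (b - Finsupp.single u 1 + indicatorExp (insert u S)) = some v := by
    intro u hu hbu
    rw [indicatorExp_insert hu, ← add_assoc, tsub_add_cancel_of_le, hp]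
    simpa [Nat.one_le_iff_ne_zero] using hbu
  rw [coeff_koszulD]
  -- If `v ∈ S`, the cycle condition at `S.erase v` expresses the coefficient of `f S` through the
  -- other terms, and these match the differential of the homotopy. If `v ∉ S`, only inserting `v`
  -- itself contributes.
  by_cases hv : v ∈ S
  · have hz : coeff (Finsupp.single v 1 + b) (koszulD (X : σ → MvPolynomial σ K) f (S.erase v)) = 0 := by rw [hf]; simp
    rw [coeff_koszulD, Finset.compl_erase,
      Finset.sum_insert (by simpa using hv), if_pos (by simp), add_tsub_cancel_left,
      Finset.insert_erase hv] at hz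
    have hsv : koszulSign v (S.erase v) = koszulSign v S := by
      conv_rhs => rw [← Finset.insert_erase hv, koszulSign_insert_self]
    rw [hsv] at hz
    have hz' := congrArg (koszulSign v S • ·) hz
    simp only [smul_add, smul_smul, koszulSign_mul_self, one_smul, smul_zero] at hz'
    rw [eq_neg_of_add_eq_zero_left hz', Finset.smul_sum, ← Finset.sum_neg_distrib]
    refine Finset.sum_congr rfl fun u hu => ?_
    rw [Finset.mem_compl] at hu
    have huv : u ≠ v := fun h => hu (h ▸ hv)
    have hbu : (Finsupp.single v 1 + b : σ →₀ ℕ) u = b u := by simp [huv.symm]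
    rw [hbu]
    by_cases hb : b u ≠ 0
    · rw [if_pos hb, if_pos hb,
        coeff_koszulHomotopy_of_mem (key u hu hb) (Finset.mem_insert_of_mem hv),
        Finset.erase_insert_of_ne huv, smul_smul, smul_smul, ← neg_smul,
        add_tsub_assoc_of_le (by simpa [Nat.one_le_iff_ne_zero] using hb)]
      congr 1
      have h1 := koszulSign_anticomm huv (S := S.erase v) (by simp [hu]) (by simp)
      have h2 : koszulSign v (insert u S) = koszulSign v (insert u (S.erase v)) := by
        conv_lhs => rw [← Finset.insert_erase hv, Finset.insert_comm, koszulSign_insert_self]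
      rw [Finset.insert_erase hv, hsv, ← h2] at h1
      have e2 := koszulSign_mul_self u S
      have e3 := koszulSign_mul_self u (S.erase v)
      linear_combination (koszulSign u S * koszulSign u (S.erase v)) * h1
        - (koszulSign u S * koszulSign v (insert u S)) * e3
        - (koszulSign v S * koszulSign u (S.erase v)) * e2
    · rw [if_neg hb, if_neg hb, smul_zero, smul_zero, smul_zero, neg_zero]
  · have hbv : b v ≠ 0 := by simpa [indicatorExp_apply, hv] using hne
    rw [Finset.sum_eq_single_of_mem v (by simpa using hv), if_pos hbv,
      coeff_koszulHomotopy_of_mem (key v hv hbv) (Finset.mem_insert_self _ _), smul_smul,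
      koszulSign_insert_self, koszulSign_mul_self, one_smul, Finset.erase_insert hv,
      add_tsub_cancel_of_le (by simpa [Nat.one_le_iff_ne_zero] using hbv)]
    intro u hu huv
    rw [Finset.mem_compl] at hu
    by_cases hb : b u ≠ 0
    · rw [if_pos hb, coeff_koszulHomotopy_of_notMem, smul_zero]
      intro w hw
      rw [key u hu hb]
      rintro h
      obtain rfl : v = w := by simpa using h
      rw [Finset.mem_insert] at hw
      exact hw.elim (fun h => huv h.symm) hv
    · rw [if_neg hb, smul_zero]

end Homotopy

/-! ### Graded free modules, graded submodules and minimal covers. -/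

section Graded

variable {σ K : Type*} [Field K]

theorem IsHomogeneousOfDegree.zero (k : ℤ) :
    IsHomogeneousOfDegree (0 : MvPolynomial σ K) k := by
  simp [IsHomogeneousOfDegree]

theorem IsHomogeneousOfDegree.add {p q : MvPolynomial σ K} {k : ℤ}
    (hp : IsHomogeneousOfDegree p k) (hq : IsHomogeneousOfDegree q k) :
    IsHomogeneousOfDegree (p + q) k := by
  classical
  intro s hs
  rcases Finset.mem_union.1 (support_add hs) with h | h
  exacts [hp s h, hq s h]

theorem IsHomogeneousOfDegree.sum {ι : Type*} {t : Finset ι} {p : ι → MvPolynomial σ K} {k : ℤ}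
    (h : ∀ i ∈ t, IsHomogeneousOfDegree (p i) k) :
    IsHomogeneousOfDegree (∑ i ∈ t, p i) k :=
  Finset.sum_induction p (IsHomogeneousOfDegree · k) (fun _ _ => .add) (.zero k) h

theorem IsHomogeneousOfDegree.mul {p q : MvPolynomial σ K} {k l : ℤ}
    (hp : IsHomogeneousOfDegree p k) (hq : IsHomogeneousOfDegree q l) :
    IsHomogeneousOfDegree (p * q) (k + l) := by
  classical
  intro s hs
  obtain ⟨a, ha, b, hb, rfl⟩ := Finset.mem_add.1 (support_mul p q hs)
  rw [map_add, Nat.cast_add, hp a ha, hq b hb]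

/-- The homogeneous component of a polynomial in an integral degree. -/
noncomputable def component (k : ℤ) (p : MvPolynomial σ K) : MvPolynomial σ K :=
  restrict {s | ((s.degree : ℕ) : ℤ) = k} p

theorem coeff_component (k : ℤ) (p : MvPolynomial σ K) (s : σ →₀ ℕ) :
    coeff s (component k p) = if ((s.degree : ℕ) : ℤ) = k then coeff s p else 0 := by
  classical
  simp [component, coeff_restrict]

theorem isHomogeneousOfDegree_component (k : ℤ) (p : MvPolynomial σ K) :
    IsHomogeneousOfDegree (component k p) k := by
  intro s hs
  rw [mem_support_iff, coeff_component] at hs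
  by_contra h
  exact hs (if_neg h)

theorem component_sum {ι : Type*} (k : ℤ) (t : Finset ι) (p : ι → MvPolynomial σ K) :
    component k (∑ i ∈ t, p i) = ∑ i ∈ t, component k (p i) := by
  ext s
  simp only [coeff_component, coeff_sum]
  split_ifs <;> simp

theorem component_mul {q : MvPolynomial σ K} {l : ℤ} (hq : IsHomogeneousOfDegree q l) (k : ℤ)
    (p : MvPolynomial σ K) : component k (p * q) = component (k - l) p * q := by
  classical
  ext s
  have h : ∀ x ∈ Finset.HasAntidiagonal.antidiagonal s, coeff x.1 (component (k - l) p) * coeff x.2 q =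
      if ((s.degree : ℕ) : ℤ) = k then coeff x.1 p * coeff x.2 q else 0 := by
    intro x hx
    rw [Finset.HasAntidiagonal.mem_antidiagonal] at hx
    by_cases hc : x.2 ∈ q.support
    · have hd : ((x.1.degree : ℕ) : ℤ) = k - l ↔ ((s.degree : ℕ) : ℤ) = k := by
        rw [← hx, map_add, Nat.cast_add, hq _ hc, eq_sub_iff_add_eq]
      rw [coeff_component, ite_mul, zero_mul]
      simp only [hd]
    · rw [notMem_support_iff.1 hc]
      simp
  rw [coeff_component, coeff_mul, coeff_mul, Finset.sum_congr rfl h]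
  split_ifs <;> simp

theorem sum_component {p : MvPolynomial σ K} {N : Finset ℤ}
    (h : ∀ s ∈ p.support, ((s.degree : ℕ) : ℤ) ∈ N) : ∑ k ∈ N, component k p = p := by
  ext s
  simp only [coeff_sum, coeff_component, Finset.sum_ite_eq]
  by_cases hs : s ∈ p.support
  · rw [if_pos (h s hs)]
  · rw [notMem_support_iff.1 hs, ite_self]

variable {ι ι' : Type*}

/-- Homogeneity of degree `d` of an element of the graded free module `⨁_a R(-s a)`. -/
def IsHomogeneousVec (s : ι → ℤ) (f : ι → MvPolynomial σ K) (d : ℤ) : Prop :=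
  ∀ a, IsHomogeneousOfDegree (f a) (d - s a)

/-- A map between graded free modules is homogeneous of degree `0`. -/
def IsGradedMap [DecidableEq ι] (s : ι → ℤ) (s' : ι' → ℤ)
    (φ : (ι → MvPolynomial σ K) →ₗ[MvPolynomial σ K] (ι' → MvPolynomial σ K)) : Prop :=
  ∀ a, IsHomogeneousVec s' (φ (Pi.single a 1)) (s a)

/-- The homogeneous component of degree `d` in the graded free module `⨁_a R(-s a)`. -/
noncomputable def componentVec (s : ι → ℤ) (d : ℤ) (f : ι → MvPolynomial σ K) :
    ι → MvPolynomial σ K :=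
  fun a => component (d - s a) (f a)

theorem isHomogeneousVec_componentVec (s : ι → ℤ) (d : ℤ) (f : ι → MvPolynomial σ K) :
    IsHomogeneousVec s (componentVec s d f) d :=
  fun _ => isHomogeneousOfDegree_component _ _

theorem exists_sum_componentVec [Finite ι] (s : ι → ℤ) (f : ι → MvPolynomial σ K) :
    ∃ N : Finset ℤ, ∑ d ∈ N, componentVec s d f = f := by
  classical
  cases nonempty_fintype ι
  refine ⟨Finset.univ.biUnion fun a => (f a).support.image fun e => ((e.degree : ℕ) : ℤ) + s a, ?_⟩
  ext1 a
  rw [Finset.sum_apply]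
  simp only [componentVec]
  set N := Finset.univ.biUnion fun a => (f a).support.image fun e => ((e.degree : ℕ) : ℤ) + s a
  rw [← Finset.sum_image (s := N) (g := fun d => d - s a) (f := fun k => component k (f a))
    (fun _ _ _ _ h => by simpa using h)]
  refine sum_component fun e he => Finset.mem_image.2 ⟨((e.degree : ℕ) : ℤ) + s a, ?_, by simp⟩
  exact Finset.mem_biUnion.2 ⟨a, Finset.mem_univ _, Finset.mem_image_of_mem _ he⟩

section Map

variable [Fintype ι] [DecidableEq ι] {s : ι → ℤ} {s' : ι' → ℤ}
  {φ : (ι → MvPolynomial σ K) →ₗ[MvPolynomial σ K] (ι' → MvPolynomial σ K)}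

theorem map_apply_eq_sum (φ : (ι → MvPolynomial σ K) →ₗ[MvPolynomial σ K] (ι' → MvPolynomial σ K))
    (f : ι → MvPolynomial σ K) (a' : ι') : φ f a' = ∑ a, f a * φ (Pi.single a 1) a' := by
  conv_lhs => rw [LinearMap.pi_apply_eq_sum_univ φ f]
  simp only [Finset.sum_apply, Pi.smul_apply, smul_eq_mul]
  refine Finset.sum_congr rfl fun a _ => ?_
  have h : (fun b => if a = b then 1 else 0 : ι → MvPolynomial σ K) = Pi.single a 1 := by
    ext1 b
    simp only [Pi.single_apply, eq_comm]
  rw [h]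

theorem IsGradedMap.isHomogeneousVec (h : IsGradedMap s s' φ) {f : ι → MvPolynomial σ K} {d : ℤ}
    (hf : IsHomogeneousVec s f d) : IsHomogeneousVec s' (φ f) d := by
  intro a'
  rw [map_apply_eq_sum]
  refine .sum fun a _ => ?_
  have := (hf a).mul (h a a')
  rwa [sub_add_sub_cancel] at this

theorem IsGradedMap.map_componentVec (h : IsGradedMap s s' φ) (f : ι → MvPolynomial σ K) (d : ℤ) :
    φ (componentVec s d f) = componentVec s' d (φ f) := by
  ext1 a'
  rw [componentVec, map_apply_eq_sum, map_apply_eq_sum, component_sum]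
  refine Finset.sum_congr rfl fun a _ => ?_
  rw [component_mul (h a a'), componentVec]
  congr 2
  ring

/-- A submodule of a graded free module is graded: it is spanned by homogeneous elements. -/
def IsGradedSubmodule (s : ι → ℤ)
    (N : Submodule (MvPolynomial σ K) (ι → MvPolynomial σ K)) : Prop :=
  N ≤ Submodule.span _ {f | f ∈ N ∧ ∃ d, IsHomogeneousVec s f d}

/-- A graded map commutes with taking homogeneous components, so the components of a kernel element
lie in the kernel. -/
theorem IsGradedMap.isGradedSubmodule_ker (h : IsGradedMap s s' φ) :
    IsGradedSubmodule s (LinearMap.ker φ) := by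
  intro f hf
  obtain ⟨N, hN⟩ := exists_sum_componentVec s f
  rw [← hN]
  refine Submodule.sum_mem _ fun d _ => Submodule.subset_span
    ⟨?_, d, isHomogeneousVec_componentVec s d f⟩
  rw [LinearMap.mem_ker] at hf ⊢
  rw [h.map_componentVec, hf]
  ext1 a
  ext e
  simp [componentVec, coeff_component]

end Map

variable [Finite ι]

theorem IsGradedSubmodule.exists_generators [Finite σ] {s : ι → ℤ}
    {N : Submodule (MvPolynomial σ K) (ι → MvPolynomial σ K)} (h : IsGradedSubmodule s N) :
    ∃ (r : ℕ) (t : Fin r → ℤ) (g : Fin r → ι → MvPolynomial σ K),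
      (∀ b, IsHomogeneousVec s (g b) (t b)) ∧ Submodule.span _ (Set.range g) = N := by
  have hN : Submodule.span _ {f | f ∈ N ∧ ∃ d, IsHomogeneousVec s f d} = N :=
    le_antisymm (Submodule.span_le.2 fun f hf => hf.1) h
  have hfg : N.FG := IsNoetherian.noetherian N
  rw [← hN] at hfg
  obtain ⟨u, hu, hspan⟩ := Submodule.fg_span_iff_fg_span_finset_subset _ |>.1 hfg
  choose! t ht using fun f (hf : f ∈ u) => (hu hf).2
  refine ⟨u.card, fun b => t (u.equivFin.symm b), fun b => u.equivFin.symm b,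
    fun b => ht _ (u.equivFin.symm b).2, ?_⟩
  rw [← hN, hspan]
  congr 1
  ext f
  constructor
  · rintro ⟨b, rfl⟩
    exact (u.equivFin.symm b).2
  · intro hf
    exact ⟨u.equivFin ⟨f, hf⟩, by simp⟩

theorem component_zero_eq_C (p : MvPolynomial σ K) :
    component 0 p = C (constantCoeff p) := by
  classical
  ext e
  rw [coeff_component, coeff_C, constantCoeff_eq]
  simp only [Nat.cast_eq_zero, Finsupp.degree_eq_zero_iff, @eq_comm _ e 0]
  split_ifs with h
  · rw [h]
  · rfl

/-- Graded Nakayama in elementary form: among homogeneous generating families take one of least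
size. A relation with a nonzero constant term would make a generator redundant. -/
theorem IsGradedSubmodule.exists_minimal_cover [Finite σ] {s : ι → ℤ}
    {N : Submodule (MvPolynomial σ K) (ι → MvPolynomial σ K)} (h : IsGradedSubmodule s N) :
    ∃ (r : ℕ) (t : Fin r → ℤ)
      (ψ : (Fin r → MvPolynomial σ K) →ₗ[MvPolynomial σ K] (ι → MvPolynomial σ K)),
      IsGradedMap t s ψ ∧ LinearMap.range ψ = N ∧
        ∀ f ∈ LinearMap.ker ψ, ∀ a, constantCoeff (f a) = 0 := by
  classical
  have hex := h.exists_generators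
  obtain ⟨t, g, hg, hspan⟩ := Nat.find_spec hex
  have hmin := fun r (hr : r < Nat.find hex) => Nat.find_min hex hr
  generalize Nat.find hex = r at *
  have hgr : IsGradedMap t s (Fintype.linearCombination (MvPolynomial σ K) g) := by
    intro b
    simpa using hg b
  refine ⟨r, t, Fintype.linearCombination _ g, hgr,
    by rw [Fintype.range_linearCombination, hspan], ?_⟩
  intro f hf b
  by_contra hc
  obtain _ | r := r
  · exact b.elim0
  refine hmin r (Nat.lt_succ_self r) ⟨t ∘ b.succAbove, g ∘ b.succAbove, fun _ => hg _, ?_⟩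
  rw [← hspan]
  refine le_antisymm (Submodule.span_mono (Set.range_comp_subset_range _ _))
    (Submodule.span_le.2 ?_)
  rintro _ ⟨c, rfl⟩
  by_cases hcb : c = b
  swap
  · obtain ⟨c, rfl⟩ := Fin.exists_succAbove_eq hcb
    exact Submodule.subset_span ⟨c, rfl⟩
  subst c
  -- The component of the relation in degree `t b` is again a relation, and its entry at `b` is a
  -- nonzero constant, so `g b` can be solved for.
  have hz : Fintype.linearCombination (MvPolynomial σ K) g (componentVec t (t b) f) = 0 := by
    rw [hgr.map_componentVec, LinearMap.mem_ker.1 hf]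
    ext1 a
    ext e
    simp [componentVec, coeff_component]
  rw [Fintype.linearCombination_apply, Fin.sum_univ_succAbove _ b] at hz
  have hb : componentVec t (t b) f b = C (constantCoeff (f b)) := by
    rw [componentVec, sub_self, component_zero_eq_C]
  rw [hb] at hz
  have hz' := congrArg (C (σ := σ) (constantCoeff (f b))⁻¹ • ·) hz
  simp only [smul_add, smul_smul, ← C_mul, inv_mul_cancel₀ hc, smul_zero, C_1, one_smul] at hz'
  rw [SetLike.mem_coe, eq_neg_of_add_eq_zero_left hz']
  refine Submodule.neg_mem _ (Submodule.smul_mem _ _ (Submodule.sum_mem _ fun c _ =>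
    Submodule.smul_mem _ _ (Submodule.subset_span ⟨c, rfl⟩)))

end Graded

/-! ### Existence of minimal graded free resolutions. -/

section Existence

variable {σ K : Type*} [Field K]

/-- An ideal as a submodule of the free module of rank one. -/
noncomputable def rankOne (I : Ideal (MvPolynomial σ K)) :
    Submodule (MvPolynomial σ K) (Fin 1 → MvPolynomial σ K) :=
  Submodule.comap (LinearMap.proj (R := MvPolynomial σ K) (0 : Fin 1)) I

theorem isGradedSubmodule_rankOne {A : Set (MvPolynomial σ K)}
    (hA : ∀ p ∈ A, ∃ k, IsHomogeneousOfDegree p k) :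
    IsGradedSubmodule (fun _ : Fin 1 => (0 : ℤ)) (rankOne (Ideal.span A)) := by
  intro f hf
  have hf' : f 0 ∈ Ideal.span A := hf
  have hff : f = LinearMap.pi (R := MvPolynomial σ K) (fun _ : Fin 1 => LinearMap.id) (f 0) := by
    ext1 i
    rw [Subsingleton.elim i 0]
    rfl
  rw [hff]
  generalize f 0 = p at hf'
  clear hf hff
  refine Submodule.span_induction (p := fun p _ => LinearMap.pi (fun _ : Fin 1 => LinearMap.id) p ∈
    Submodule.span _ {f | f ∈ rankOne (Ideal.span A) ∧
      ∃ d, IsHomogeneousVec (fun _ : Fin 1 => (0 : ℤ)) f d}) ?_ ?_ ?_ ?_ hf'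
  · intro p hp
    obtain ⟨k, hk⟩ := hA p hp
    exact Submodule.subset_span ⟨Ideal.subset_span hp, k, fun _ => by simpa using hk⟩
  · simp
  · intro p q _ _ hp hq
    rw [map_add]
    exact add_mem hp hq
  · intro c p _ hp
    rw [map_smul]
    exact Submodule.smul_mem _ _ hp

/-- A graded submodule of a graded free module of finite rank. -/
structure GradedStage (σ K : Type*) [Field K] where
  rank : ℕ
  shift : Fin rank → ℤ
  carrier : Submodule (MvPolynomial σ K) (Fin rank → MvPolynomial σ K)
  isGraded : IsGradedSubmodule shift carrier

variable [Finite σ]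

namespace GradedStage

variable (A : GradedStage σ K)

/-- The minimal number of homogeneous generators. -/
noncomputable def nextRank : ℕ := A.isGraded.exists_minimal_cover.choose

/-- The degrees of the minimal homogeneous generators. -/
noncomputable def nextShift : Fin A.nextRank → ℤ :=
  A.isGraded.exists_minimal_cover.choose_spec.choose

/-- The minimal cover of a graded submodule by a graded free module. -/
noncomputable def cover :
    (Fin A.nextRank → MvPolynomial σ K) →ₗ[MvPolynomial σ K] (Fin A.rank → MvPolynomial σ K) :=
  A.isGraded.exists_minimal_cover.choose_spec.choose_spec.choose

theorem isGradedMap_cover : IsGradedMap A.nextShift A.shift A.cover :=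
  A.isGraded.exists_minimal_cover.choose_spec.choose_spec.choose_spec.1

theorem range_cover : LinearMap.range A.cover = A.carrier :=
  A.isGraded.exists_minimal_cover.choose_spec.choose_spec.choose_spec.2.1

theorem constantCoeff_of_mem_ker_cover {f : Fin A.nextRank → MvPolynomial σ K}
    (hf : f ∈ LinearMap.ker A.cover) (a : Fin A.nextRank) : constantCoeff (f a) = 0 :=
  A.isGraded.exists_minimal_cover.choose_spec.choose_spec.choose_spec.2.2 f hf a

/-- The syzygies of the minimal homogeneous generators. -/
noncomputable def next : GradedStage σ K where
  rank := A.nextRank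
  shift := A.nextShift
  carrier := LinearMap.ker A.cover
  isGraded := A.isGradedMap_cover.isGradedSubmodule_ker

/-- The iterated syzygies. -/
noncomputable def iter : ℕ → GradedStage σ K
  | 0 => A
  | k + 1 => (iter k).next

/-- The map between the covers of consecutive syzygies. -/
noncomputable def iterMap (i : ℕ) : (Fin (A.iter (i + 1)).nextRank → MvPolynomial σ K)
    →ₗ[MvPolynomial σ K] (Fin (A.iter i).nextRank → MvPolynomial σ K) :=
  (A.iter (i + 1)).cover

theorem isGradedMap_iterMap (i : ℕ) :
    IsGradedMap (A.iter (i + 1)).nextShift (A.iter i).nextShift (A.iterMap i) :=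
  (A.iter (i + 1)).isGradedMap_cover

theorem range_iterMap_zero : LinearMap.range (A.iterMap 0) = LinearMap.ker A.cover :=
  (A.iter 1).range_cover

theorem range_iterMap_succ (i : ℕ) :
    LinearMap.range (A.iterMap (i + 1)) = LinearMap.ker (A.iterMap i) :=
  (A.iter (i + 2)).range_cover

theorem constantCoeff_iterMap (i : ℕ) (f : Fin (A.iter (i + 1)).nextRank → MvPolynomial σ K)
    (a : Fin (A.iter i).nextRank) : constantCoeff (A.iterMap i f a) = 0 := by
  have h : LinearMap.range (A.iterMap i) = LinearMap.ker (A.iter i).cover :=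
    (A.iter (i + 1)).range_cover
  exact (A.iter i).constantCoeff_of_mem_ker_cover (h ▸ LinearMap.mem_range_self _ f) a

end GradedStage

theorem exists_isMinimal {A : Set (MvPolynomial σ K)}
    (hA : ∀ p ∈ A, ∃ k, IsHomogeneousOfDegree p k) :
    ∃ F : GradedFreeResolution (Ideal.span A), F.IsMinimal := by
  let S : GradedStage σ K := ⟨1, fun _ => 0, _, isGradedSubmodule_rankOne hA⟩
  let c : (Fin (S.iter 0).nextRank → MvPolynomial σ K) →ₗ[MvPolynomial σ K]
    (Fin 1 → MvPolynomial σ K) := S.cover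
  have hc : IsGradedMap (S.iter 0).nextShift (fun _ : Fin 1 => 0) c := S.isGradedMap_cover
  have hrange : LinearMap.range c = rankOne (Ideal.span A) := S.range_cover
  have hker : LinearMap.range (S.iterMap 0) = LinearMap.ker c := S.range_iterMap_zero
  clear_value c
  refine ⟨{
    rank i := (S.iter i).nextRank
    shift i := (S.iter i).nextShift
    d := S.iterMap
    aug := LinearMap.proj (0 : Fin 1) ∘ₗ c
    d_homogeneous i b a := S.isGradedMap_iterMap i b a
    aug_homogeneous b := by simpa using hc b 0
    range_aug := ?_
    exact_zero := LinearMap.exact_iff.2 ?_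
    exact_succ i := LinearMap.exact_iff.2 (S.range_iterMap_succ i).symm },
    fun i b a => S.constantCoeff_iterMap i _ a⟩
  · rw [LinearMap.range_comp, hrange]
    exact Submodule.map_comap_eq_of_surjective (LinearMap.proj_surjective 0) _
  · rw [hker]
    ext f
    rw [LinearMap.mem_ker, LinearMap.mem_ker]
    constructor
    · intro hf
      ext1 i
      rw [Subsingleton.elim i 0]
      exact hf
    · intro hf
      exact congrFun hf 0

end Existence

/-! ### The choice of variable for the homotopy. -/

section PickVar

variable {σ : Type*}

open Classical in
/-- A variable in the support of an exponent, of exponent at least two if there is one. -/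
noncomputable def pickVar (a : σ →₀ ℕ) : Option σ :=
  if h : ∃ v, 2 ≤ a v then some h.choose
  else if h : ∃ v, a v ≠ 0 then some h.choose else none

theorem pickVar_ne_zero {a : σ →₀ ℕ} {v : σ} (h : pickVar a = some v) : a v ≠ 0 := by
  unfold pickVar at h
  split_ifs at h with h1 h2
  · obtain rfl := Option.some.inj h
    have := h1.choose_spec
    omega
  · obtain rfl := Option.some.inj h
    exact h2.choose_spec

theorem two_le_of_pickVar {a : σ →₀ ℕ} {u v : σ} (h : pickVar a = some v) (hu : 2 ≤ a u) :
    2 ≤ a v := by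
  unfold pickVar at h
  rw [dif_pos ⟨u, hu⟩] at h
  obtain rfl := Option.some.inj h
  exact Exists.choose_spec (⟨u, hu⟩ : ∃ v, 2 ≤ a v)

theorem eq_zero_of_pickVar {a : σ →₀ ℕ} (h : pickVar a = none) : a = 0 := by
  unfold pickVar at h
  split_ifs at h with h1 h2
  push Not at h2
  exact Finsupp.ext h2

end PickVar

/-! ### From Koszul vanishing to bounds on shifts. -/

section Regularity

variable {σ K : Type*} [Field K]

/-- Bounding the shifts of every minimal resolution covers the one chosen in `bettiNumber`, so
uniqueness is not needed; `hex` excludes the default value `⊤`. -/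
theorem regularity_le {I : Ideal (MvPolynomial σ K)} {r : ℤ}
    (hex : ∃ F : GradedFreeResolution I, F.IsMinimal)
    (h : ∀ F : GradedFreeResolution I, F.IsMinimal → ∀ i b, F.shift i b ≤ r + i) :
    regularity I ≤ ((r : ℝ) : EReal) := by
  rw [regularity, if_pos hex]
  refine iSup_le fun i => iSup_le fun j => iSup_le fun hb => ?_
  rw [bettiNumber, dif_pos hex, GradedFreeResolution.mult, ← Nat.pos_iff_ne_zero,
    Fintype.card_pos_iff] at hb
  obtain ⟨b, rfl⟩ := hb
  have := h _ hex.choose_spec i b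
  rw [EReal.coe_le_coe_iff, Int.cast_le]
  linarith

theorem constantCoeff_map_eq_zero [Fintype ι] [DecidableEq ι] {ι' : Type*}
    {φ : (ι → MvPolynomial σ K) →ₗ[MvPolynomial σ K] (ι' → MvPolynomial σ K)}
    (h : ∀ b a, constantCoeff (φ (Pi.single b 1) a) = 0) (f : ι → MvPolynomial σ K) (a : ι') :
    constantCoeff (φ f a) = 0 := by
  rw [map_apply_eq_sum]
  simp [h]

variable [LinearOrder σ]

theorem isHomogeneousOfDegree_koszulHomotopy {pick : (σ →₀ ℕ) → Option σ}
    {f : Finset σ → MvPolynomial σ K} {d : ℤ} (hf : ∀ S, IsHomogeneousOfDegree (f S) d)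
    (T : Finset σ) : IsHomogeneousOfDegree (koszulHomotopy pick f T) (d - 1) := by
  intro b hb
  obtain ⟨v, _, _, h⟩ := exists_of_mem_support_koszulHomotopy hb
  have := hf _ _ h
  rw [map_add, Finsupp.degree_single] at this
  push_cast at this
  linarith

variable [Fintype σ]

/-- The Koszul homology of `N ⊆ ⨁_a R(-s a)` vanishes in coefficient degrees above `r`: the cycles
with homogeneous coefficients of such a degree are boundaries. -/
def KoszulBounded {ι : Type*} (s : ι → ℤ)
    (N : Submodule (MvPolynomial σ K) (ι → MvPolynomial σ K)) (r : ℤ) : Prop :=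
  ∀ d > r, ∀ z : Finset σ → ι → MvPolynomial σ K, (∀ S, z S ∈ N) →
    (∀ S, IsHomogeneousVec s (z S) d) → koszulD (X : σ → MvPolynomial σ K) z = 0 →
    ∃ w : Finset σ → ι → MvPolynomial σ K,
      (∀ S, w S ∈ N) ∧ koszulD (X : σ → MvPolynomial σ K) w = z

variable {ι : Type*}

/-- The contracting homotopy on Koszul chains over a free module. -/
noncomputable def koszulHomotopyVec (z : Finset σ → ι → MvPolynomial σ K) :
    Finset σ → ι → MvPolynomial σ K :=
  fun T a => koszulHomotopy pickVar (fun S => z S a) T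

theorem koszulD_apply_apply (z : Finset σ → ι → MvPolynomial σ K) (S : Finset σ) (a : ι) :
    koszulD (X : σ → MvPolynomial σ K) z S a =
      koszulD (X : σ → MvPolynomial σ K) (fun T => z T a) S :=
  (koszulD_map X (LinearMap.proj (R := MvPolynomial σ K) a) z S).symm

theorem koszulD_koszulHomotopyVec {z : Finset σ → ι → MvPolynomial σ K}
    (hz : koszulD (X : σ → MvPolynomial σ K) z = 0) (h0 : ∀ a, constantCoeff (z ∅ a) = 0) :
    koszulD (X : σ → MvPolynomial σ K) (koszulHomotopyVec z) = z := by
  ext1 S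
  ext1 a
  rw [koszulD_apply_apply]
  refine congrFun (koszulD_koszulHomotopy (fun _ _ => pickVar_ne_zero)
    (fun _ => eq_zero_of_pickVar) (f := fun T => z T a) ?_ (h0 a)) S
  ext1 T
  rw [← koszulD_apply_apply, hz]
  rfl

/-- Dimension shifting, the connecting map of Koszul homology made explicit. A cycle in the kernel
bounds some `w` in the free module, of coefficient degree one lower; `φ ∘ w` is then a cycle in the
image, where the bound `r` applies. -/
theorem KoszulBounded.ker [Fintype ι] [DecidableEq ι] {ι' : Type*} {s : ι → ℤ} {s' : ι' → ℤ}
    {φ : (ι → MvPolynomial σ K) →ₗ[MvPolynomial σ K] (ι' → MvPolynomial σ K)}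
    (hφ : IsGradedMap s s' φ) {r : ℤ} (h : KoszulBounded s' (LinearMap.range φ) r)
    (hmin : ∀ f ∈ LinearMap.ker φ, ∀ a, constantCoeff (f a) = 0) :
    KoszulBounded s (LinearMap.ker φ) (r + 1) := by
  intro d hd z hzN hz hcyc
  have hw := koszulD_koszulHomotopyVec hcyc (hmin _ (hzN ∅))
  have hwd (S : Finset σ) : IsHomogeneousVec s (koszulHomotopyVec z S) (d - 1) := by
    intro a
    have := isHomogeneousOfDegree_koszulHomotopy (pick := pickVar) (fun S => hz S a) S
    rwa [sub_right_comm] at this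
  generalize koszulHomotopyVec z = w at hw hwd
  obtain ⟨u, hu, hdu⟩ := h (d - 1) (by linarith) (fun S => φ (w S))
    (fun S => LinearMap.mem_range_self φ _) (fun S => hφ.isHomogeneousVec (hwd S)) (by
      ext1 S
      rw [koszulD_map, hw]
      exact hzN S)
  choose t ht using hu
  -- Subtracting the boundary of a lift `t` moves `w` into the kernel without changing its
  -- differential.
  refine ⟨w - koszulD (X : σ → MvPolynomial σ K) t, fun S => ?_, ?_⟩
  · rw [LinearMap.mem_ker, Pi.sub_apply, map_sub, ← koszulD_map]
    simp only [ht]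
    rw [sub_eq_zero]
    exact (congrFun hdu S).symm
  · rw [map_sub, koszulD_koszulD, sub_zero, hw]

/-- A minimal generator is a nonzero class in zeroth Koszul homology: were it a boundary, it would
be a combination of elements of the image with coefficients in the maximal ideal. -/
theorem KoszulBounded.shift_le [Fintype ι] [DecidableEq ι] {ι' : Type*} {s : ι → ℤ} {s' : ι' → ℤ}
    {φ : (ι → MvPolynomial σ K) →ₗ[MvPolynomial σ K] (ι' → MvPolynomial σ K)}
    (hφ : IsGradedMap s s' φ) {r : ℤ} (h : KoszulBounded s' (LinearMap.range φ) r)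
    (hmin : ∀ f ∈ LinearMap.ker φ, ∀ a, constantCoeff (f a) = 0) (b : ι) : s b ≤ r := by
  by_contra! hb
  -- A chain supported at `∅` is a cycle, since the differential only reads nonempty sets.
  obtain ⟨w, hw, hdw⟩ := h (s b) hb (fun S => if S = ∅ then φ (Pi.single b 1) else 0)
    (fun S => by
      split_ifs
      exacts [LinearMap.mem_range_self φ _, zero_mem _])
    (fun S => by
      split_ifs
      exacts [hφ b, fun a => .zero _])
    (by
      ext1 S
      rw [koszulD_apply]
      simp)
  choose y hy using hw
  obtain rfl : (fun S => φ (y S)) = w := funext hy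
  have h0 := congrFun hdw ∅
  rw [koszulD_map, if_pos rfl] at h0
  -- This kernel element has constant term `-1` at `b`, which contradicts minimality.
  have hk := hmin (koszulD (X : σ → MvPolynomial σ K) y ∅ - Pi.single b 1)
    (by rw [LinearMap.mem_ker, map_sub, h0, sub_self]) b
  rw [Pi.sub_apply, koszulD_apply_apply, koszulD_apply] at hk
  simp [map_sum] at hk

theorem GradedFreeResolution.IsMinimal.shift_le {I : Ideal (MvPolynomial σ K)}
    {F : GradedFreeResolution I} (hF : F.IsMinimal) {r : ℤ}
    (h : KoszulBounded (fun _ : Fin 1 => (0 : ℤ)) (rankOne I) r) (i : ℕ) (b : Fin (F.rank i)) :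
    F.shift i b ≤ r + i := by
  let c : (Fin (F.rank 0) → MvPolynomial σ K) →ₗ[MvPolynomial σ K] (Fin 1 → MvPolynomial σ K) :=
    LinearMap.pi fun _ => F.aug
  have hcg : IsGradedMap (F.shift 0) (fun _ : Fin 1 => (0 : ℤ)) c := by
    intro b _
    simpa [c] using F.aug_homogeneous b
  have hker : LinearMap.ker c = LinearMap.range (F.d 0) := by
    rw [← LinearMap.exact_iff.1 F.exact_zero]
    simp [c, LinearMap.ker_pi]
  have hrange : LinearMap.range c = rankOne I := by
    ext f
    have hI : f ∈ rankOne I ↔ f 0 ∈ LinearMap.range F.aug := by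
      rw [F.range_aug]
      rfl
    rw [hI]
    constructor
    · rintro ⟨g, rfl⟩
      exact ⟨g, rfl⟩
    · rintro ⟨g, hg⟩
      refine ⟨g, ?_⟩
      ext1 j
      rw [Subsingleton.elim j 0]
      exact hg
  have hmin (i : ℕ) (f) (hf : f ∈ LinearMap.range (F.d i)) (a : Fin (F.rank i)) :
      constantCoeff (f a) = 0 := by
    obtain ⟨g, rfl⟩ := hf
    exact constantCoeff_map_eq_zero (hF i) g a
  have hd (i : ℕ) : LinearMap.ker (F.d i) = LinearMap.range (F.d (i + 1)) :=
    LinearMap.exact_iff.1 (F.exact_succ i)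
  have hdg (i : ℕ) : IsGradedMap (F.shift (i + 1)) (F.shift i) (F.d i) := F.d_homogeneous i
  rw [← hrange] at h
  -- The image of `F.d i` is the syzygy module number `i + 1`, and each syzygy step costs 1.
  have hb (i : ℕ) : KoszulBounded (F.shift i) (LinearMap.range (F.d i)) (r + (i + 1 : ℕ)) := by
    induction i with
    | zero =>
      rw [← hker]
      simpa using h.ker hcg (hker ▸ hmin 0)
    | succ i ih =>
      rw [← hd]
      have := ih.ker (hdg i) (hd i ▸ hmin (i + 1))
      rwa [add_assoc, ← Nat.cast_succ] at this
  cases i with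
  | zero => simpa using h.shift_le hcg (hker ▸ hmin 0) b
  | succ i => exact (hb i).shift_le (hdg i) (hd i ▸ hmin (i + 1)) b

end Regularity

/-! ### Edge ideals of graphs whose complement is triangle-free. -/

section EdgeIdeal

variable {σ : Type*} (K : Type*) [Field K] (G : SimpleGraph σ)

theorem connectedIdeal_one : connectedIdeal K G 1 =
    Ideal.span ((fun e => monomial e (1 : K)) ''
      {e | ∃ u v, G.Adj u v ∧ e = Finsupp.single u 1 + Finsupp.single v 1}) := by
  classical
  unfold connectedIdeal
  congr 1
  ext f
  constructor
  · rintro ⟨S, hS, hc, rfl⟩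
    obtain ⟨u, v, huv, rfl⟩ := Finset.card_eq_two.1 hS
    refine ⟨_, ⟨u, v, ?_, rfl⟩, ?_⟩
    -- In a connected graph on two vertices `u` has a neighbour, which can only be `v`.
    · have : Nontrivial (({u, v} : Finset σ) : Set σ) :=
        ⟨⟨u, by simp⟩, ⟨v, by simp⟩, by simpa using huv⟩
      obtain ⟨⟨w, hw⟩, hadj⟩ := hc.preconnected.exists_adj_of_nontrivial ⟨u, by simp⟩
      rw [SimpleGraph.comap_adj] at hadj
      have hw' : w = u ∨ w = v := by simpa using hw
      obtain rfl | rfl := hw'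
      · exact absurd hadj (G.loopless.irrefl _)
      · exact hadj
    · rw [Finset.prod_pair huv]
      simp [X, monomial_mul]
  · rintro ⟨_, ⟨u, v, h, rfl⟩, rfl⟩
    refine ⟨{u, v}, Finset.card_pair h.ne, ?_, ?_⟩
    · rw [Finset.coe_pair]
      exact SimpleGraph.induce_pair_connected_of_adj h
    · rw [Finset.prod_pair h.ne]
      simp [X, monomial_mul]

theorem mem_connectedIdeal_one {p : MvPolynomial σ K} : p ∈ connectedIdeal K G 1 ↔
    ∀ a ∈ p.support, ∃ u v, G.Adj u v ∧ a u ≠ 0 ∧ a v ≠ 0 := by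
  classical
  rw [connectedIdeal_one, mem_ideal_span_monomial_image]
  refine forall₂_congr fun a _ => ?_
  constructor
  · rintro ⟨_, ⟨u, v, h, rfl⟩, hle⟩
    have hu := hle u
    have hv := hle v
    simp only [Finsupp.add_apply, Finsupp.single_eq_same] at hu hv
    exact ⟨u, v, h, by omega, by omega⟩
  · rintro ⟨u, v, h, hu, hv⟩
    refine ⟨_, ⟨u, v, h, rfl⟩, fun w => ?_⟩
    simp only [Finsupp.add_apply, Finsupp.single_apply]
    have := h.ne
    split_ifs with h1 h2 h2
    · exact absurd (h1.trans h2.symm) this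
    · subst h1; omega
    · subst h2; omega
    · omega

variable {G} in
theorem koszulBounded_connectedIdeal_one [Fintype σ] [LinearOrder σ] (hG : Gᶜ.CliqueFree 3) :
    KoszulBounded (fun _ : Fin 1 => (0 : ℤ)) (rankOne (connectedIdeal K G 1)) 3 := by
  intro d hd z hzI hz hcyc
  have hzI' (S : Finset σ) : z S 0 ∈ connectedIdeal K G 1 := hzI S
  refine ⟨koszulHomotopyVec z, fun T => ?_, koszulD_koszulHomotopyVec hcyc fun a => ?_⟩
  · change koszulHomotopy pickVar (fun S => z S 0) T ∈ connectedIdeal K G 1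
    rw [mem_connectedIdeal_one]
    intro b hb
    obtain ⟨v, hvT, hv, hs⟩ := exists_of_mem_support_koszulHomotopy hb
    -- If some exponent is at least 2, so is that of the picked `v`, and `b` still contains `v`
    -- after the division.
    by_cases h2 : ∃ u, 2 ≤ (b + indicatorExp T) u
    · obtain ⟨u, hu⟩ := h2
      have hbv := two_le_of_pickVar hv hu
      rw [Finsupp.add_apply, indicatorExp_apply, if_pos hvT] at hbv
      have hsupp (x : σ) (hx : (Finsupp.single v 1 + b : σ →₀ ℕ) x ≠ 0) : b x ≠ 0 := by
        by_cases hxv : x = v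
        · subst hxv
          omega
        · simpa [Finsupp.single_apply, Ne.symm hxv] using hx
      obtain ⟨x, y, hxy, hx, hy⟩ := (mem_connectedIdeal_one K G).1 (hzI' _) _ hs
      exact ⟨x, y, hxy, hsupp x hx, hsupp y hy⟩
    · push Not at h2
      have hb1 (x : σ) : b x ≤ 1 := by
        have := h2 x
        rw [Finsupp.add_apply] at this
        omega
      have hdeg := hz _ 0 _ hs
      rw [map_add, Finsupp.degree_single] at hdeg
      -- Here `b` is squarefree of degree `d - 1`, and `d > 3`.
      have hcard : 3 ≤ b.support.card := by
        have : b.degree ≤ b.support.card := by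
          rw [Finsupp.degree, Finset.card_eq_sum_ones]
          exact Finset.sum_le_sum fun x _ => hb1 x
        push_cast at hdeg
        omega
      obtain ⟨t, ht, htc⟩ := Finset.exists_subset_card_eq hcard
      have hnc := hG t
      rw [SimpleGraph.isNClique_iff, not_and_or, or_iff_left (not_not.2 htc),
        SimpleGraph.isClique_iff, Set.Pairwise] at hnc
      push Not at hnc
      obtain ⟨x, hx, y, hy, hxy, hadj⟩ := hnc
      rw [SimpleGraph.compl_adj, not_and, not_not] at hadj
      exact ⟨x, y, hadj hxy, Finsupp.mem_support_iff.1 (ht hx), Finsupp.mem_support_iff.1 (ht hy)⟩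
  -- Coefficients of degree `d > 3` have no constant term.
  · by_contra h
    rw [constantCoeff_eq, ← ne_eq, ← mem_support_iff] at h
    have := hz ∅ a 0 h
    simp at this
    omega

theorem regularity_connectedIdeal_one_le [Finite σ] (hG : Gᶜ.CliqueFree 3) :
    regularity (connectedIdeal K G 1) ≤ 3 := by
  classical
  cases nonempty_fintype σ
  let _ : LinearOrder σ := linearOrderOfSTO WellOrderingRel
  have hex : ∃ F : GradedFreeResolution (connectedIdeal K G 1), F.IsMinimal := by
    refine exists_isMinimal ?_
    rintro _ ⟨S, hS, _, rfl⟩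
    refine ⟨∑ _ ∈ S, 1, ?_⟩
    have h : ∏ x ∈ S, (X x : MvPolynomial σ K) = monomial (indicatorExp S) 1 := by
      simp [indicatorExp, monomial_sum_one, X]
    rw [h]
    intro a ha
    obtain rfl := Finset.mem_singleton.1 (support_monomial_subset ha)
    simp [indicatorExp]
  have := regularity_le hex (r := 3) fun F hF =>
    hF.shift_le (koszulBounded_connectedIdeal_one K hG)
  exact_mod_cast this

end EdgeIdeal

theorem cliqueFree_gridGraph (n m : ℕ) : (gridGraph n m).CliqueFree 3 := by
  intro t ht
  obtain ⟨x, y, z, hxy, hxz, hyz, -⟩ := SimpleGraph.is3Clique_iff.1 ht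
  -- Adjacent grid vertices have coordinate sums of opposite parity, and three vertices cannot
  -- pairwise differ in parity.
  have key (u v : Fin n × Fin m) (h : (gridGraph n m).Adj u v) :
      ((u.1 : ℕ) + u.2) % 2 ≠ ((v.1 : ℕ) + v.2) % 2 := by
    rw [gridGraph_adj] at h
    rcases abs_cases (((u.1 : ℕ) : ℤ) - ((v.1 : ℕ) : ℤ)) with h1 | h1 <;>
      rcases abs_cases (((u.2 : ℕ) : ℤ) - ((v.2 : ℕ) : ℤ)) with h2 | h2 <;> omega
  have h1 := key x y hxy
  have h2 := key x z hxz
  have h3 := key y z hyz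
  omega

end ConnectedIdeal

theorem mainTheorem9 (K : Type*) [Field K] (n m : ℕ) :
    ConnectedIdeal.regularity
      (ConnectedIdeal.connectedIdeal K (ConnectedIdeal.gridGraph n m)ᶜ 1) ≤ 3 :=
  ConnectedIdeal.regularity_connectedIdeal_one_le K _
    (by rw [compl_compl]; exact ConnectedIdeal.cliqueFree_gridGraph n m)
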